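/- Model. In a uniform gossip algorithm on $n$ nodes the computation proceeds in synchronized rounds. In each round every node chooses, depending on its current state, to push or to pull, and is assigned a contact that is uniformly random among the other $n-1$ nodes; all contacts are independent of each other and of the random tapes of the nodes. A node that pushes chooses a message, which is delivered to its contact; a node that pulls receives a message that its contact computes from its state at the beginning of the round. States and messages may be of arbitrary size. The initial state of a node depends on its name, its random tape and its input value, and the tapes may have an arbitrary joint law (so private and shared coins are both allowed). After $T$ rounds every node outputs a value computed from its state. Problem. Given input values $x_v\in\mathbb N$, one for each node $v$, the $\epsilon$-approximate $\phi$-quantile problem asks every node to output one of the input values whose rank (the $k$-th smallest value has rank $k$) lies between $(\phi-\epsilon)n$ and $(\phi+\epsilon)n$. The algorithm fails if at least one node outputs a value that is not of this kind. Theorem. There is an absolute constant $N$ such that the following holds for all $n\ge N$, all real $\epsilon$ with $\frac{10\ln n}{n}<\epsilon<\frac18$, all $\phi\in[0,1]$ and all integers $T\ge 0$ with $$T<\tfrac12\log_2\log_2 n\qquad\text{or}\qquad T<\log_4\tfrac8\epsilon .$$ For every gossip algorithm on $n$ nodes (which may depend on $n,\epsilon,\phi,T$) that runs for $T$ rounds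 there is an input of pairwise distinct values from $\{1,\dots,2n\}$ (so of $O(\log n)$ bits each) on which it fails to solve the $\epsilon$-approximate $\phi$-quantile problem with probability at least $1/3$. Message sizes are unlimited. -/

import Mathlib

open MeasureTheory ProbabilityTheory

/-- What a node does in a round: push a message to its random contact, or pull from it. -/
inductive GossipAction (M : Type) where
  | push (m : M)
  | pull

/-- The random contacts of one round: every node has one contact, a node other than itself. -/
abbrev GossipContacts (n : ℕ) : Type := (v : Fin n) → {u : Fin n // u ≠ v}

/-- A gossip algorithm on `n` nodes whose inputs and outputs are natural numbers.
States and messages are of arbitrary types, so that message sizes are unlimited. Node `v` starts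
with its name, its random tape and its input value, all of which it may keep in its state, as it
may keep a round counter. The joint law of the tapes is arbitrary: independent tapes are private
coins, equal tapes are shared coins. -/
structure GossipAlgorithm (n : ℕ) where
  /-- the values of a random tape -/
  Seed : Type
  [seedMeasurableSpace : MeasurableSpace Seed]
  /-- the joint law of the random tapes of all nodes -/
  seedLaw : Measure (Fin n → Seed)
  [seedLaw_isProbabilityMeasure : IsProbabilityMeasure seedLaw]
  State : Type
  Msg : Type
  /-- the initial state of a node, from its name, its random tape and its input value -/
  init : Fin n → Seed → ℕ → State
  /-- the choice between push and pull, with the message to be pushed -/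
  action : State → GossipAction Msg
  /-- the message that a node hands to the nodes that pull from it -/
  reply : State → Msg
  /-- the new state of a node, from its old state, its contact in this round, the message it
  pulled from that contact (if it pulled), and the messages pushed to it (indexed by sender) -/
  update : State → Fin n → Option Msg → (Fin n → Option Msg) → State
  output : State → ℕ

namespace GossipAlgorithm

attribute [instance] seedMeasurableSpace seedLaw_isProbabilityMeasure

variable {n : ℕ} (A : GossipAlgorithm n)

/-- The message that node `v` pulls in a round, if it pulls. -/
def pulled (c : GossipContacts n) (st : Fin n → A.State) (v : Fin n) : Option A.Msg :=
  match A.action (st v) with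
  | .push _ => none
  | .pull => some (A.reply (st (c v)))

/-- The message that node `u` pushes to node `v` in a round, if it does. -/
def pushed (c : GossipContacts n) (st : Fin n → A.State) (v u : Fin n) : Option A.Msg :=
  match A.action (st u) with
  | .push m => if (c u : Fin n) = v then some m else none
  | .pull => none

/-- One synchronous round with contacts `c`. -/
def step (c : GossipContacts n) (st : Fin n → A.State) (v : Fin n) : A.State :=
  A.update (st v) (c v) (A.pulled c st v) (A.pushed c st v)

/-- The states after `T` rounds on input `x` with random tapes `r`, where `c i` holds the contacts
of round `i`. -/
def run (x : Fin n → ℕ) (r : Fin n → A.Seed) :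
    (T : ℕ) → (Fin T → GossipContacts n) → Fin n → A.State
  | 0, _ => fun v => A.init v (r v) (x v)
  | T + 1, c => A.step (c (Fin.last T)) (run x r T (fun i => c i.castSucc))

/-- The law of the randomness of a `T`-round execution: the tapes have law `seedLaw`, and
independently of them all contacts are independent, each uniform among the other nodes. -/
noncomputable def executionLaw (T : ℕ) :
    Measure ((Fin n → A.Seed) × (Fin T → GossipContacts n)) :=
  A.seedLaw.prod (uniformOn Set.univ)

end GossipAlgorithm

/-- `y` is the `k`-th smallest of the values `x v` (counted with multiplicity, starting at `1`),
that is, `y` is one of these values and has rank `k`. -/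
def HasRank {n : ℕ} (x : Fin n → ℕ) (y k : ℕ) : Prop :=
  (Finset.univ.filter fun v => x v < y).card < k ∧ k ≤ (Finset.univ.filter fun v => x v ≤ y).card

/-- `y` is a correct answer to the `ε`-approximate `φ`-quantile problem on input `x`: a value whose
rank is between `(φ - ε) n` and `(φ + ε) n`. -/
def IsApproxQuantile {n : ℕ} (ε φ : ℝ) (x : Fin n → ℕ) (y : ℕ) : Prop :=
  ∃ k : ℕ, HasRank x y k ∧ (φ - ε) * n ≤ k ∧ (k : ℝ) ≤ (φ + ε) * n

/-- The event that a `T`-round execution on input `x` fails to solve the `ε`-approximate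
`φ`-quantile problem: some node ends with an incorrect output. -/
def GossipAlgorithm.failure {n : ℕ} (A : GossipAlgorithm n) (ε φ : ℝ) (T : ℕ) (x : Fin n → ℕ) :
    Set ((Fin n → A.Seed) × (Fin T → GossipContacts n)) :=
  {ω | ∃ v, ¬ IsApproxQuantile ε φ x (A.output (A.run x ω.1 T ω.2 v))}

/-!
The proof couples the executions on two inputs. Let `d` be the least integer above `2 ε n`, and
compare the input `1, …, n` with the one in which the `d` nodes holding `1, …, d` hold
`n + 1, …, n + d` instead. A correct answer is at most `(φ + ε) n` for the first input and at least
`d + (φ - ε) n > (φ + ε) n` for the second, so that no value is correct for both. A node that no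
chain of contacts links to those `d` nodes has the same state in both executions
(`GossipAlgorithm.run_eq_of_mem_uninformed`), so it errs on one of the inputs. Hence, if such an
uninformed node exists after `T` rounds with probability at least `2 / 3`, one of the two inputs
makes the algorithm fail with probability at least `1 / 3`
(`GossipAlgorithm.exists_one_div_three_le_failure`). The event that an uninformed node exists
depends on the contacts only; this makes it measurable, although the failure events need not be.

It remains to bound the spread of information when every node both pushes and pulls. There are two
estimates.

* Second moment. If `m` nodes are uninformed, each of them stays so with probability of order
  `m / n`, and these events are negatively correlated, so Chebyshev's inequality shows that order
  `m ^ 2 / n` nodes stay uninformed, with high probability. Iterating this leaves an uninformed node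
  whenever `64 ^ (4 * 2 ^ T) ≤ n` (`three_mul_card_uninformed_eq_empty_le_of_pow_le`). This covers
  `T < 1 / 2 * log₂ log₂ n`, and also every bounded `T` once `n` is large.
* First moment. The expected number of informed nodes at most triples in each round, so by Markov's
  inequality an uninformed node is left whenever `3 * 3 ^ T * d ≤ n`
  (`three_mul_card_uninformed_eq_empty_le_of_mul_le`). As `d ≤ 3 ε n`, the bound `4 ^ T < 8 / ε`
  implies this as soon as `(3 / 4) ^ T ≤ 1 / 72`, that is for `T ≥ 15`.
-/

open Finset

/-! ### Uninformed nodes and the coupling of two inputs -/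

section Coupling

variable {n : ℕ}

/-- The nodes that no information from outside `U` reaches in a round with contacts `c`, if `U`
was the set of such nodes before. Every node is treated as if it both pushed to and pulled from
its contact, so that the set does not depend on the algorithm. -/
def uninformedStep (c : GossipContacts n) (U : Finset (Fin n)) : Finset (Fin n) :=
  U.filter fun v => (c v : Fin n) ∈ U ∧ ∀ u, u ∉ U → (c u : Fin n) ≠ v

/-- The nodes that no information from outside `U` has reached after `T` rounds. -/
def uninformed (U : Finset (Fin n)) : (T : ℕ) → (Fin T → GossipContacts n) → Finset (Fin n)
  | 0, _ => U
  | T + 1, c => uninformedStep (c (Fin.last T)) (uninformed U T fun i => c i.castSucc)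

/-- Two inputs that agree on `U` lead to the same states on the nodes that remain uninformed. -/
lemma GossipAlgorithm.run_eq_of_mem_uninformed (A : GossipAlgorithm n) {x y : Fin n → ℕ}
    {U : Finset (Fin n)} (hxy : ∀ v ∈ U, x v = y v) (r : Fin n → A.Seed) (T : ℕ)
    (c : Fin T → GossipContacts n) :
    ∀ v ∈ uninformed U T c, A.run x r T c v = A.run y r T c v := by
  induction T with
  | zero =>
    intro v hv
    simp only [GossipAlgorithm.run]
    rw [hxy v hv]
  | succ T ih =>
    intro v hv
    simp only [uninformed, uninformedStep, mem_filter] at hv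
    obtain ⟨hvU, hcv, hpush⟩ := hv
    have ih' := ih fun i => c i.castSucc
    simp only [GossipAlgorithm.run, GossipAlgorithm.step]
    congr 1
    · exact ih' v hvU
    · simp only [GossipAlgorithm.pulled]
      rw [ih' v hvU, ih' _ hcv]
    · funext u
      simp only [GossipAlgorithm.pushed]
      by_cases hu : u ∈ uninformed U T fun i => c i.castSucc
      · rw [ih' u hu]
      · -- an informed node may act differently on the two inputs, but it does not reach `v`
        simp only [if_neg (hpush u hu)]
        split <;> split <;> rfl

end Coupling

/-! ### Two inputs without a common correct answer -/

section Inputs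

variable {n : ℕ}

lemma IsApproxQuantile.le_of_eq_succ {ε φ : ℝ} {y : ℕ}
    (h : IsApproxQuantile ε φ (fun v : Fin n => (v : ℕ) + 1) y) : (y : ℝ) ≤ (φ + ε) * n := by
  obtain ⟨k, ⟨hlt, hle⟩, -, hk⟩ := h
  refine le_trans ?_ hk
  -- a value that has a rank is one of the inputs
  have hne : ∃ v : Fin n, (v : ℕ) + 1 = y := by
    by_contra! hne
    refine absurd (hlt.trans_le hle) (not_lt.mpr (card_le_card fun v hv => ?_))
    have := hne v
    simp only [mem_filter, mem_univ, true_and] at hv ⊢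
    omega
  obtain ⟨v, rfl⟩ := hne
  have hcard : (univ.filter fun w : Fin n => (w : ℕ) + 1 < (v : ℕ) + 1).card = v := by
    rw [← Fin.card_Iio v]
    congr 1
    ext w
    simp
  rw [hcard] at hlt
  exact_mod_cast hlt

lemma IsApproxQuantile.le_of_forall_lt {ε φ : ℝ} {y d : ℕ} {x : Fin n → ℕ}
    (hx : Function.Injective x) (hd : ∀ v, d < x v) (h : IsApproxQuantile ε φ x y) :
    d + (φ - ε) * n ≤ y := by
  obtain ⟨k, ⟨hlt, hle⟩, hk, -⟩ := h
  have hcard : (univ.filter fun v => x v ≤ y).card ≤ y - d := by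
    rw [← Nat.card_Ioc, ← card_image_of_injective _ hx]
    refine card_le_card fun z hz => ?_
    simp only [mem_image, mem_filter, mem_univ, true_and] at hz
    obtain ⟨v, hv, rfl⟩ := hz
    exact mem_Ioc.mpr ⟨hd v, hv⟩
  have hky : k + d ≤ y := by omega
  have : (k : ℝ) + d ≤ y := by exact_mod_cast hky
  linarith

/-- The input `1, …, n`, except that the `d` smallest values are replaced by `n + 1, …, n + d`. -/
def shiftedInput (n d : ℕ) (v : Fin n) : ℕ :=
  if (v : ℕ) < d then v + 1 + n else v + 1

lemma shiftedInput_injective (n d : ℕ) : Function.Injective (shiftedInput n d) := by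
  intro v w h
  have hv := v.isLt
  have hw := w.isLt
  unfold shiftedInput at h
  ext
  split_ifs at h <;> omega

lemma lt_shiftedInput {d : ℕ} (hd : d ≤ n) (v : Fin n) : d < shiftedInput n d v := by
  unfold shiftedInput
  split_ifs <;> omega

lemma shiftedInput_le (d : ℕ) (v : Fin n) : shiftedInput n d v ≤ 2 * n := by
  unfold shiftedInput
  split_ifs <;> omega

end Inputs

/-! ### Counting contacts -/

section Counting

variable {n : ℕ}

/-- Summation over the choices of `T + 1` rounds, the last round innermost. -/
lemma sum_fin_succ_fun {M C : Type*} [AddCommMonoid M] [Fintype C] (T : ℕ)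
    (f : C → (Fin T → C) → M) :
    ∑ c : Fin (T + 1) → C, f (c (Fin.last T)) (fun i => c i.castSucc) =
      ∑ c : Fin T → C, ∑ e : C, f e c := by
  rw [← (Fin.snocEquiv fun _ : Fin (T + 1) => C).sum_comp, Fintype.sum_prod_type, sum_comm]
  simp [Fin.snocEquiv]

lemma card_contacts (n : ℕ) : Fintype.card (GossipContacts n) = (n - 1) ^ n := by
  simp [GossipContacts, Fintype.card_pi, Fintype.card_subtype_compl]

/-- A node is not its own contact, so that it has `(S w).erase w` to choose from. -/
lemma card_filter_forall_contact_mem (S : Fin n → Finset (Fin n)) :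
    (univ.filter fun c : GossipContacts n => ∀ w, (c w : Fin n) ∈ S w).card =
      ∏ w, ((S w).erase w).card := by
  have : (univ.filter fun c : GossipContacts n => ∀ w, (c w : Fin n) ∈ S w) =
      Fintype.piFinset fun w => (S w).subtype (· ≠ w) := by
    ext c
    simp
  rw [this, Fintype.card_piFinset]
  refine prod_congr rfl fun w _ => ?_
  rw [card_subtype, filter_ne']

/-- The number of contact choices for which all nodes of `R` stay uninformed in one round: nodes of
`R` have their contacts in `U`, other nodes of `U` have arbitrary contacts, and informed nodes have
their contacts outside `R`. -/
lemma card_filter_subset_uninformedStep {R U : Finset (Fin n)} (hRU : R ⊆ U) :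
    (univ.filter fun c : GossipContacts n => R ⊆ uninformedStep c U).card =
      (#U - 1) ^ #R * (n - 1) ^ (#U - #R) * (n - #R - 1) ^ (n - #U) := by
  have hset : (univ.filter fun c : GossipContacts n => R ⊆ uninformedStep c U) =
      univ.filter fun c : GossipContacts n => ∀ w, (c w : Fin n) ∈
        if w ∈ R then U else if w ∈ U then univ else Rᶜ := by
    ext c
    simp only [mem_filter, mem_univ, true_and, uninformedStep, subset_iff]
    constructor
    · intro h w
      split_ifs with hR hU
      · exact (h hR).2.1
      · exact mem_univ _
      · exact mem_compl.mpr fun hc => (h hc).2.2 w hU rfl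
    · intro h v hv
      refine ⟨hRU hv, by simpa [hv] using h v, fun u hu huv => ?_⟩
      have := h u
      rw [if_neg fun hR => hu (hRU hR), if_neg hu, mem_compl, huv] at this
      exact this hv
  rw [hset, card_filter_forall_contact_mem, ← prod_mul_prod_compl U, ← prod_sdiff hRU]
  have h1 : ∀ w ∈ U \ R,
      #((if w ∈ R then U else if w ∈ U then univ else Rᶜ).erase w) = n - 1 := by
    intro w hw
    rw [mem_sdiff] at hw
    simp [hw.1, hw.2]
  have h2 : ∀ w ∈ R, #((if w ∈ R then U else if w ∈ U then univ else Rᶜ).erase w) = #U - 1 := by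
    intro w hw
    simp [hw, card_erase_of_mem (hRU hw)]
  have h3 : ∀ w ∈ Uᶜ,
      #((if w ∈ R then U else if w ∈ U then univ else Rᶜ).erase w) = n - #R - 1 := by
    intro w hw
    rw [mem_compl] at hw
    have hR : w ∉ R := fun h => hw (hRU h)
    rw [if_neg hR, if_neg hw, card_erase_of_mem (mem_compl.mpr hR), card_compl, Fintype.card_fin]
  rw [prod_congr rfl h1, prod_congr rfl h2, prod_congr rfl h3]
  simp only [prod_const, card_sdiff_of_subset hRU, card_compl, Fintype.card_fin]
  ring

end Counting

/-! ### The second moment of the number of uninformed nodes -/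

section SecondMoment

variable {n : ℕ}

/-- Chebyshev's inequality for a variable on a finite set whose variance is at most its mean. -/
lemma card_filter_lt_half_mul_le {Ω : Type*} [Fintype Ω] (Z : Ω → ℝ) {μ : ℝ} (hμ : 0 < μ)
    (h1 : ∑ c, Z c = Fintype.card Ω * μ)
    (h2 : ∑ c, Z c ^ 2 ≤ Fintype.card Ω * μ + Fintype.card Ω * μ ^ 2) :
    (#(univ.filter fun c => Z c < μ / 2) : ℝ) * μ ≤ 4 * Fintype.card Ω := by
  have hvar : ∑ c, (Z c - μ) ^ 2 ≤ Fintype.card Ω * μ := by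
    have : ∑ c, (Z c - μ) ^ 2 = ∑ c, Z c ^ 2 - 2 * μ * ∑ c, Z c + Fintype.card Ω * μ ^ 2 := by
      rw [mul_sum, ← sum_sub_distrib]
      have : (Fintype.card Ω : ℝ) * μ ^ 2 = ∑ _c : Ω, μ ^ 2 := by simp
      rw [this, ← sum_add_distrib]
      exact sum_congr rfl fun c _ => by ring
    rw [this, h1]
    linarith
  have hle : (#(univ.filter fun c => Z c < μ / 2) : ℝ) * (μ ^ 2 / 4) ≤ ∑ c, (Z c - μ) ^ 2 := by
    rw [← nsmul_eq_mul]
    refine (card_nsmul_le_sum _ _ _ fun c hc => ?_).trans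
      (sum_le_univ_sum_of_nonneg fun c => sq_nonneg (Z c - μ))
    have := (mem_filter.mp hc).2
    nlinarith
  have := hle.trans hvar
  refine le_of_mul_le_mul_right ?_ hμ
  linarith

/-- `(1 - 1 / k) ^ j` is bounded below for `j ≤ k`. In a round it bounds the probability that no
informed node pushes to a given node. -/
lemma one_div_eight_le_pow {k j : ℕ} (hk : 2 ≤ k) (hj : j ≤ k) :
    (1 / 8 : ℝ) ≤ (((k - 1 : ℕ) : ℝ) / k) ^ j := by
  have hk1 : (1 : ℝ) ≤ ((k - 1 : ℕ) : ℝ) := by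
    exact_mod_cast (by omega : 1 ≤ k - 1)
  have hkr : (k : ℝ) = ((k - 1 : ℕ) : ℝ) + 1 := by
    exact_mod_cast (by omega : k = k - 1 + 1)
  set a : ℝ := ((k - 1 : ℕ) : ℝ)
  have hle : a / k ≤ 1 := by rw [hkr, div_le_one (by positivity)]; linarith
  refine le_trans ?_ (pow_le_pow_of_le_one (by positivity) hle hj)
  -- `1 + 1 / (k - 1) ≤ exp (1 / (k - 1))` gives `(1 - 1 / k) ^ k ≥ exp (- k / (k - 1)) ≥ exp (- 2)`
  have hinv : ((k : ℝ) / a) ^ k ≤ 8 := by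
    calc ((k : ℝ) / a) ^ k ≤ Real.exp (1 / a) ^ k := by
          gcongr
          have := Real.add_one_le_exp (1 / a)
          rw [hkr, add_div, div_self (by positivity)]
          linarith
      _ = Real.exp (k * (1 / a)) := (Real.exp_nat_mul _ _).symm
      _ ≤ Real.exp (1 + 1) := by
          gcongr
          rw [mul_one_div, div_le_iff₀ (by positivity), hkr]
          linarith
      _ ≤ 8 := by
          rw [Real.exp_add]
          nlinarith [Real.exp_one_lt_d9, Real.exp_pos 1]
  have hpos : 0 < ((k : ℝ) / a) ^ k := by
    have : (0 : ℝ) < k := by rw [hkr]; positivity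
    positivity
  rw [← inv_div (k : ℝ) a, inv_pow, one_div]
  exact inv_anti₀ hpos hinv

/-- Two nodes of `U` stay uninformed with at most the product of their probabilities: the round
makes these events negatively correlated, so that the variance of the number of nodes that stay
uninformed is at most its mean. -/
lemma card_contacts_mul_card_pair_le {U : Finset (Fin n)} {v w : Fin n} (hv : v ∈ U) (hw : w ∈ U)
    (hvw : v ≠ w) :
    (n - 1) ^ n * #(univ.filter fun c : GossipContacts n => {v, w} ⊆ uninformedStep c U) ≤
      ((#U - 1) * (n - 1) ^ (#U - 1) * (n - 2) ^ (n - #U)) ^ 2 := by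
  have hR : ({v, w} : Finset (Fin n)) ⊆ U := by
    intro z hz
    rcases mem_insert.mp hz with rfl | hz
    · exact hv
    · rwa [mem_singleton.mp hz]
  rw [card_filter_subset_uninformedStep hR, card_pair hvw]
  have hU2 : 2 ≤ #U := by rw [← card_pair hvw]; exact card_le_card hR
  have hUn : #U ≤ n := by simpa using card_le_univ U
  obtain ⟨a, ha⟩ : ∃ a, #U = a + 2 := ⟨#U - 2, by omega⟩
  obtain ⟨b, rfl⟩ : ∃ b, n = a + 2 + b := ⟨n - (a + 2), by omega⟩
  have hprod : (a + 2 + b - 1) * (a + 2 + b - 2 - 1) ≤ (a + 2 + b - 2) ^ 2 := by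
    have h1 : a + 2 + b - 1 = a + b + 1 := by omega
    have h2 : a + 2 + b - 2 = a + b := by omega
    rw [h1, h2]
    rcases Nat.eq_zero_or_pos (a + b) with h | h
    · simp [h]
    · obtain ⟨e, he⟩ : ∃ e, a + b = e + 1 := ⟨a + b - 1, by omega⟩
      rw [he, Nat.add_sub_cancel]
      nlinarith
  have hb : a + 2 + b - #U = b := by omega
  have ha1 : #U - 1 = a + 1 := by omega
  have ha2 : #U - 2 = a := by omega
  rw [hb, ha1, ha2]
  calc (a + 2 + b - 1) ^ (a + 2 + b) *
        ((a + 1) ^ 2 * (a + 2 + b - 1) ^ a * (a + 2 + b - 2 - 1) ^ b)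
      = (a + 1) ^ 2 * (a + 2 + b - 1) ^ (2 * (a + 1)) *
          ((a + 2 + b - 1) * (a + 2 + b - 2 - 1)) ^ b := by
        rw [mul_pow]
        ring
    _ ≤ (a + 1) ^ 2 * (a + 2 + b - 1) ^ (2 * (a + 1)) * ((a + 2 + b - 2) ^ 2) ^ b := by
        gcongr
    _ = ((a + 1) * (a + 2 + b - 1) ^ (a + 1) * (a + 2 + b - 2) ^ b) ^ 2 := by ring

lemma cast_card_eq_sum_ite (U : Finset (Fin n)) (c : GossipContacts n) :
    (#(uninformedStep c U) : ℝ) = ∑ v ∈ U, if {v} ⊆ uninformedStep c U then 1 else 0 := by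
  rw [sum_boole]
  congr 2
  ext v
  simp only [singleton_subset_iff, mem_filter, uninformedStep]
  tauto

/-- If at least `a` nodes are uninformed, then after one more round at least `a ^ 2 / (32 n)` are,
except with probability at most `64 n / a ^ 2`. -/
lemma card_filter_card_uninformedStep_lt_le {U : Finset (Fin n)} {a : ℝ} (ha : 2 ≤ a)
    (haU : a ≤ #U) :
    (#(univ.filter fun c : GossipContacts n =>
      (#(uninformedStep c U) : ℝ) < a ^ 2 / (32 * n)) : ℝ) ≤
      64 * n / a ^ 2 * Fintype.card (GossipContacts n) := by
  have hU2 : 2 ≤ #U := by exact_mod_cast ha.trans haU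
  have hUn : #U ≤ n := by simpa using card_le_univ U
  have hn1 : (1 : ℝ) ≤ ((n - 1 : ℕ) : ℝ) := by exact_mod_cast (by omega : 1 ≤ n - 1)
  set K : ℝ := (Fintype.card (GossipContacts n) : ℝ) with hK
  have hKn : K = ((n - 1 : ℕ) : ℝ) ^ n := by rw [hK, card_contacts]; push_cast; rfl
  have hKpos : 0 < K := by rw [hKn]; positivity
  set s : ℕ := (#U - 1) * (n - 1) ^ (#U - 1) * (n - 2) ^ (n - #U) with hs
  have hcard1 : ∀ v ∈ U,
      #(univ.filter fun c : GossipContacts n => {v} ⊆ uninformedStep c U) = s := by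
    intro v hv
    rw [card_filter_subset_uninformedStep (singleton_subset_iff.mpr hv), card_singleton, pow_one,
      Nat.sub_sub]
  -- `s / K` is the probability that a given node of `U` stays uninformed
  have hsK : (#U - 1 : ℝ) / (8 * n) ≤ s / K := by
    have hfac : (s : ℝ) / K = (#U - 1 : ℝ) / ((n - 1 : ℕ) : ℝ) *
        (((n - 2 : ℕ) : ℝ) / ((n - 1 : ℕ) : ℝ)) ^ (n - #U) := by
      have hpow : ((n - 1 : ℕ) : ℝ) ^ n =
          ((n - 1 : ℕ) : ℝ) * ((n - 1 : ℕ) : ℝ) ^ (#U - 1) * ((n - 1 : ℕ) : ℝ) ^ (n - #U) := by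
        rw [← pow_succ', ← pow_add]
        congr 1
        omega
      rw [hKn, hpow, hs]
      push_cast [Nat.cast_sub (by omega : 1 ≤ #U)]
      rw [div_pow]
      field_simp
    rw [hfac]
    rcases (by omega : n = 2 ∨ 3 ≤ n) with rfl | hn3
    · have : #U = 2 := by omega
      rw [this]
      norm_num
    have h8 : (1 / 8 : ℝ) ≤ (((n - 2 : ℕ) : ℝ) / ((n - 1 : ℕ) : ℝ)) ^ (n - #U) := by
      have := one_div_eight_le_pow (k := n - 1) (j := n - #U) (by omega) (by omega)
      rwa [Nat.sub_sub] at this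
    have hU1 : (0 : ℝ) ≤ #U - 1 := by linarith
    calc (#U - 1 : ℝ) / (8 * n) = (#U - 1 : ℝ) / n * (1 / 8) := by ring
      _ ≤ (#U - 1 : ℝ) / ((n - 1 : ℕ) : ℝ) *
          (((n - 2 : ℕ) : ℝ) / ((n - 1 : ℕ) : ℝ)) ^ (n - #U) := by
        gcongr
        omega
  set μ : ℝ := #U * (s / K) with hμdef
  have hnpos : (0 : ℝ) < n := by exact_mod_cast (by omega : 0 < n)
  have hμ : a ^ 2 / (16 * n) ≤ μ := by
    calc a ^ 2 / (16 * n) ≤ (#U * (#U - 1)) * 2 / (16 * n) := by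
          gcongr
          nlinarith
      _ = #U * ((#U - 1 : ℝ) / (8 * n)) := by
          field_simp
          ring
      _ ≤ μ := by
          rw [hμdef]
          gcongr
  have hμpos : 0 < μ := lt_of_lt_of_le (by positivity) hμ
  have hsum1 : ∑ c : GossipContacts n, (#(uninformedStep c U) : ℝ) = K * μ := by
    simp_rw [cast_card_eq_sum_ite]
    rw [sum_comm]
    simp_rw [sum_boole]
    rw [sum_congr rfl fun v hv => by rw [hcard1 v hv], sum_const, nsmul_eq_mul, hμdef]
    field_simp
  have hsum2 : ∑ c : GossipContacts n, (#(uninformedStep c U) : ℝ) ^ 2 ≤ K * μ + K * μ ^ 2 := by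
    have hsq : ∀ c : GossipContacts n, (#(uninformedStep c U) : ℝ) ^ 2 =
        ∑ v ∈ U, ∑ w ∈ U, if {v, w} ⊆ uninformedStep c U then 1 else 0 := by
      intro c
      rw [cast_card_eq_sum_ite, sq, sum_mul_sum]
      refine sum_congr rfl fun v _ => sum_congr rfl fun w _ => ?_
      by_cases hv : v ∈ uninformedStep c U <;> by_cases hw : w ∈ uninformedStep c U <;>
        simp [hv, hw, insert_subset_iff]
    simp_rw [hsq]
    rw [sum_comm]
    simp_rw [sum_comm (s := (univ : Finset (GossipContacts n))), sum_boole]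
    have hle : ∀ v ∈ U, ∀ w ∈ U,
        (#(univ.filter fun c : GossipContacts n => {v, w} ⊆ uninformedStep c U) : ℝ) ≤
          (if v = w then (s : ℝ) else 0) + s ^ 2 / K := by
      intro v hv w hw
      split_ifs with hvw
      · subst hvw
        rw [pair_eq_singleton, hcard1 v hv]
        have : (0 : ℝ) ≤ s ^ 2 / K := by positivity
        linarith
      · rw [zero_add, le_div_iff₀ hKpos, hKn, mul_comm]
        exact_mod_cast card_contacts_mul_card_pair_le hv hw hvw
    refine (sum_le_sum fun v hv => sum_le_sum fun w hw => hle v hv w hw).trans (le_of_eq ?_)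
    have : ∀ v ∈ U, ∑ w ∈ U, ((if v = w then (s : ℝ) else 0) + s ^ 2 / K) =
        s + #U * (s ^ 2 / K) := by
      intro v hv
      rw [sum_add_distrib, sum_ite_eq, if_pos hv, sum_const, nsmul_eq_mul]
    rw [sum_congr rfl this, sum_const, nsmul_eq_mul, hμdef]
    field_simp
  have hcheb := card_filter_lt_half_mul_le (fun c => (#(uninformedStep c U) : ℝ)) hμpos hsum1 hsum2
  have hmono : (#(univ.filter fun c : GossipContacts n =>
      (#(uninformedStep c U) : ℝ) < a ^ 2 / (32 * n)) : ℝ) ≤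
      #(univ.filter fun c : GossipContacts n => (#(uninformedStep c U) : ℝ) < μ / 2) := by
    refine Nat.cast_le.mpr (card_le_card (monotone_filter_right _ fun c _ hc => ?_))
    refine lt_of_lt_of_le hc (le_trans (le_of_eq ?_) (div_le_div_of_nonneg_right hμ zero_le_two))
    field_simp
    norm_num
  refine hmono.trans ?_
  calc _ ≤ 4 * K / μ := (le_div_iff₀ hμpos).mpr hcheb
    _ ≤ 4 * K / (a ^ 2 / (16 * n)) := by gcongr
    _ = 64 * n / a ^ 2 * K := by
      field_simp
      norm_num

/-- The number of uninformed nodes is at least `32 n / 64 ^ (2 ^ t)` with high probability: divided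
by `32 n`, the lower bound is squared in every round, and it starts at `1 / 64` because half of the
nodes are uninformed at first. -/
lemma card_filter_card_uninformed_lt_le {U : Finset (Fin n)} {T : ℕ}
    (hT : 64 ^ (4 * 2 ^ T) ≤ n) (hU : n ≤ 2 * #U) {t : ℕ} (ht : t ≤ T) :
    (#(univ.filter fun c : Fin t → GossipContacts n =>
      (#(uninformed U t c) : ℝ) < 32 * n / 64 ^ 2 ^ t) : ℝ) ≤
      t * ((64 ^ 2 ^ T) ^ 2 / (16 * n)) * Fintype.card (Fin t → GossipContacts n) := by
  have hnpos : (0 : ℝ) < n := by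
    exact_mod_cast lt_of_lt_of_le (by positivity) hT
  induction t with
  | zero =>
    rw [filter_false_of_mem]
    · simp
    · intro c _
      have : (n : ℝ) ≤ 2 * #U := by exact_mod_cast hU
      simp only [uninformed, pow_zero, pow_one]
      linarith
  | succ t ih =>
    specialize ih (by omega)
    set a : ℝ := 32 * n / 64 ^ 2 ^ t with ha
    -- `δ` bounds the failure probability of every single round
    set δ : ℝ := (64 ^ 2 ^ T) ^ 2 / (16 * n) with hδ
    have hqT : (64 : ℝ) ^ 2 ^ t ≤ 64 ^ 2 ^ T := by
      gcongr
      · norm_num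
      · norm_num
      · omega
    have hqn : (64 : ℝ) ^ 2 ^ T ≤ n := by
      refine le_trans ?_ (by exact_mod_cast hT : (64 : ℝ) ^ (4 * 2 ^ T) ≤ n)
      gcongr
      · norm_num
      · omega
    have ha2 : 2 ≤ a := by
      rw [ha, le_div_iff₀ (by positivity)]
      linarith
    have haa : a ^ 2 / (32 * n) = 32 * n / 64 ^ 2 ^ (t + 1) := by
      rw [ha, pow_succ 2 t, pow_mul]
      field_simp
    have haδ : 64 * n / a ^ 2 ≤ δ := by
      have : 64 * n / a ^ 2 = (64 ^ 2 ^ t) ^ 2 / (16 * n) := by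
        rw [ha]
        field_simp
        norm_num
      rw [this, hδ]
      gcongr
    set K : ℝ := (Fintype.card (GossipContacts n) : ℝ) with hK
    have hcardT : ∀ j : ℕ, (Fintype.card (Fin j → GossipContacts n) : ℝ) = K ^ j := by
      intro j
      simp [hK]
    rw [hcardT] at ih ⊢
    rw [← sum_boole]
    refine (le_of_eq (sum_fin_succ_fun t fun e c => if (#(uninformedStep e (uninformed U t c)) : ℝ) <
      32 * n / 64 ^ 2 ^ (t + 1) then (1 : ℝ) else 0)).trans ?_
    have hstep : ∀ c : Fin t → GossipContacts n,
        (∑ e : GossipContacts n, if (#(uninformedStep e (uninformed U t c)) : ℝ) <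
          32 * n / 64 ^ 2 ^ (t + 1) then (1 : ℝ) else 0) ≤
        (if (#(uninformed U t c) : ℝ) < a then K else 0) + δ * K := by
      intro c
      have hK0 : 0 ≤ K := by positivity
      have hδ0 : 0 ≤ δ := by positivity
      rw [sum_boole]
      split_ifs with hc
      -- once the bound has failed, the count for the next round is estimated trivially
      · have : (#(univ.filter fun e : GossipContacts n =>
            (#(uninformedStep e (uninformed U t c)) : ℝ) < 32 * n / 64 ^ 2 ^ (t + 1)) : ℝ) ≤ K :=
          Nat.cast_le.mpr (card_le_univ _)
        have := mul_nonneg hδ0 hK0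
        linarith
      · rw [zero_add, ← haa]
        refine (card_filter_card_uninformedStep_lt_le ha2 (not_lt.mp hc)).trans ?_
        gcongr
    refine (sum_le_sum fun c _ => hstep c).trans ?_
    rw [sum_add_distrib, ← sum_filter, sum_const, sum_const, nsmul_eq_mul, nsmul_eq_mul, card_univ,
      hcardT]
    have := mul_le_mul_of_nonneg_right ih (by positivity : 0 ≤ K)
    push_cast
    rw [pow_succ]
    linarith

lemma three_mul_card_uninformed_eq_empty_le_of_pow_le {U : Finset (Fin n)} {T : ℕ}
    (hT : 64 ^ (4 * 2 ^ T) ≤ n) (hU : n ≤ 2 * #U) :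
    3 * #(univ.filter fun c : Fin T → GossipContacts n => uninformed U T c = ∅) ≤
      Fintype.card (Fin T → GossipContacts n) := by
  have hnpos : (0 : ℝ) < n := by
    exact_mod_cast lt_of_lt_of_le (by positivity) hT
  have h := card_filter_card_uninformed_lt_le hT hU le_rfl
  have hmono : (#(univ.filter fun c : Fin T → GossipContacts n => uninformed U T c = ∅) : ℝ) ≤
      #(univ.filter fun c : Fin T → GossipContacts n =>
        (#(uninformed U T c) : ℝ) < 32 * n / 64 ^ 2 ^ T) := by
    refine Nat.cast_le.mpr (card_le_card (monotone_filter_right _ fun c _ hc => ?_))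
    show (#(uninformed U T c) : ℝ) < _
    rw [hc, card_empty, Nat.cast_zero]
    positivity
  have hδ : (T : ℝ) * ((64 ^ 2 ^ T) ^ 2 / (16 * n)) ≤ 1 / 3 := by
    have hTq : T ≤ 64 ^ 2 ^ T :=
      (Nat.lt_two_pow_self.le).trans (Nat.lt_pow_self (by norm_num)).le
    have hq1 : 1 ≤ 64 ^ 2 ^ T := Nat.one_le_pow _ _ (by norm_num)
    have hle : T * (64 ^ 2 ^ T) ^ 2 ≤ n := by
      calc T * (64 ^ 2 ^ T) ^ 2 ≤ 64 ^ 2 ^ T * (64 ^ 2 ^ T) ^ 2 := by gcongr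
        _ = (64 ^ 2 ^ T) ^ 3 := by ring
        _ ≤ (64 ^ 2 ^ T) ^ 4 := Nat.pow_le_pow_right hq1 (by norm_num)
        _ = 64 ^ (4 * 2 ^ T) := by rw [← pow_mul, mul_comm]
        _ ≤ n := hT
    have hle' : (T : ℝ) * (64 ^ 2 ^ T) ^ 2 ≤ n := by exact_mod_cast hle
    rw [← mul_div_assoc, div_le_iff₀ (by positivity)]
    linarith
  have : (3 * #(univ.filter fun c : Fin T → GossipContacts n => uninformed U T c = ∅) : ℝ) ≤
      Fintype.card (Fin T → GossipContacts n) := by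
    have h2 := mul_le_mul_of_nonneg_right hδ
      (Nat.cast_nonneg (α := ℝ) (Fintype.card (Fin T → GossipContacts n)))
    linarith
  exact_mod_cast this

end SecondMoment

/-! ### The first moment of the number of informed nodes -/

section FirstMoment

variable {n : ℕ}

/-- In one round the expected number of informed nodes at most triples: each informed node informs
one node by pushing and, in expectation, at most one by being pulled from. -/
lemma sum_card_compl_uninformedStep_le (U : Finset (Fin n)) :
    ∑ c : GossipContacts n, #(uninformedStep c U)ᶜ ≤ 3 * #Uᶜ * Fintype.card (GossipContacts n) := by
  have hsub : ∀ c : GossipContacts n, #(uninformedStep c U)ᶜ ≤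
      #Uᶜ + #Uᶜ + ∑ v ∈ U, if (c v : Fin n) ∈ Uᶜ then 1 else 0 := by
    intro c
    rw [← card_filter]
    -- informed nodes were informed before, are pushed to, or pull from an informed node
    have hss : (uninformedStep c U)ᶜ ⊆
        (Uᶜ ∪ Uᶜ.image fun u => (c u : Fin n)) ∪ U.filter fun v => (c v : Fin n) ∈ Uᶜ := by
      intro v hv
      simp only [uninformedStep, mem_compl, mem_filter, mem_union, mem_image] at hv ⊢
      by_contra! hcon
      obtain ⟨⟨hvU, himg⟩, hpull⟩ := hcon
      exact hv ⟨hvU, hpull hvU, himg⟩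
    refine (card_le_card hss).trans ((card_union_le _ _).trans ?_)
    gcongr
    exact (card_union_le _ _).trans (Nat.add_le_add_left card_image_le _)
  have hpull : ∀ v ∈ U, (∑ c : GossipContacts n, if (c v : Fin n) ∈ Uᶜ then 1 else 0) =
      #Uᶜ * (n - 1) ^ (n - 1) := by
    intro v hv
    rw [← card_filter]
    have hset : (univ.filter fun c : GossipContacts n => (c v : Fin n) ∈ Uᶜ) =
        univ.filter fun c : GossipContacts n => ∀ w, (c w : Fin n) ∈ if w = v then Uᶜ else univ := by
      ext c
      simp only [mem_filter, mem_univ, true_and]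
      constructor
      · intro h w
        split_ifs with hw
        · exact hw ▸ h
        · exact mem_univ _
      · intro h
        simpa using h v
    rw [hset, card_filter_forall_contact_mem, ← mul_prod_erase univ _ (mem_univ v), if_pos rfl,
      erase_eq_of_notMem (by simpa using hv)]
    congr 1
    have : ∀ w ∈ univ.erase v, #((if w = v then Uᶜ else univ).erase w) = n - 1 := by
      intro w hw
      rw [if_neg (ne_of_mem_erase hw)]
      simp
    rw [prod_congr rfl this, prod_const, card_erase_of_mem (mem_univ v), card_univ,
      Fintype.card_fin]
  refine (sum_le_sum fun c _ => hsub c).trans ?_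
  rw [sum_add_distrib, sum_const, sum_comm, sum_congr rfl hpull, sum_const, smul_eq_mul,
    smul_eq_mul, card_univ]
  have hkey : #U * (#Uᶜ * (n - 1) ^ (n - 1)) ≤ #Uᶜ * Fintype.card (GossipContacts n) := by
    rcases Nat.eq_zero_or_pos #Uᶜ with h0 | h0
    · simp [h0]
    have hadd : #U + #Uᶜ = n := by simp [card_add_card_compl]
    have hpow : (n - 1) ^ n = (n - 1) * (n - 1) ^ (n - 1) := by
      rw [← pow_succ']
      congr 1
      omega
    rw [card_contacts, hpow, mul_left_comm]
    gcongr
    omega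
  linarith

lemma sum_card_compl_uninformed_le (U : Finset (Fin n)) (T : ℕ) :
    ∑ c : Fin T → GossipContacts n, #(uninformed U T c)ᶜ ≤
      3 ^ T * #Uᶜ * Fintype.card (Fin T → GossipContacts n) := by
  induction T with
  | zero => simp [uninformed]
  | succ T ih =>
    simp only [uninformed]
    rw [sum_fin_succ_fun T fun e c => #(uninformedStep e (uninformed U T c))ᶜ]
    refine (sum_le_sum fun c _ => sum_card_compl_uninformedStep_le _).trans ?_
    rw [← sum_mul, ← mul_sum]
    calc _ ≤ 3 * (3 ^ T * #Uᶜ * Fintype.card (Fin T → GossipContacts n)) *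
          Fintype.card (GossipContacts n) := by gcongr
      _ = _ := by
        simp only [Fintype.card_fun, Fintype.card_fin]
        ring

lemma three_mul_card_uninformed_eq_empty_le_of_mul_le {U : Finset (Fin n)} {T : ℕ} (hn : 0 < n)
    (h : 3 * (3 ^ T * #Uᶜ) ≤ n) :
    3 * #(univ.filter fun c : Fin T → GossipContacts n => uninformed U T c = ∅) ≤
      Fintype.card (Fin T → GossipContacts n) := by
  have hsum : #(univ.filter fun c : Fin T → GossipContacts n => uninformed U T c = ∅) * n ≤
      ∑ c : Fin T → GossipContacts n, #(uninformed U T c)ᶜ := by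
    rw [← smul_eq_mul]
    refine (card_nsmul_le_sum _ _ _ fun c hc => ?_).trans
      (sum_le_sum_of_subset (filter_subset _ _))
    simp [(mem_filter.mp hc).2]
  have := hsum.trans (sum_card_compl_uninformed_le U T)
  refine Nat.le_of_mul_le_mul_right ?_ hn
  calc _ ≤ 3 * (3 ^ T * #Uᶜ * Fintype.card (Fin T → GossipContacts n)) := by linarith
    _ = 3 * (3 ^ T * #Uᶜ) * Fintype.card (Fin T → GossipContacts n) := by ring
    _ ≤ n * Fintype.card (Fin T → GossipContacts n) := by gcongr
    _ = _ := mul_comm _ _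

end FirstMoment

/-! ### From uninformed nodes to failure -/

section Failure

variable {n : ℕ}

/-- The execution law of the event that an uninformed node is left, from the counting bound. -/
lemma GossipAlgorithm.two_div_three_le_executionLaw (A : GossipAlgorithm n) (hn : 2 ≤ n) {T : ℕ}
    {U : Finset (Fin n)}
    (h : 3 * #(univ.filter fun c : Fin T → GossipContacts n => uninformed U T c = ∅) ≤
      Fintype.card (Fin T → GossipContacts n)) :
    2 / 3 ≤ A.executionLaw T (Set.univ ×ˢ {c | (uninformed U T c).Nonempty}) := by
  have hcard : 0 < Fintype.card (Fin T → GossipContacts n) := by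
    have : 0 < n - 1 := by omega
    simp only [Fintype.card_fun, card_contacts]
    positivity
  have : Nonempty (Fin T → GossipContacts n) := Fintype.card_pos_iff.mp hcard
  have hset : {c : Fin T → GossipContacts n | (uninformed U T c).Nonempty} =
      ((univ.filter fun c : Fin T → GossipContacts n => ¬ uninformed U T c = ∅ :
        Finset (Fin T → GossipContacts n)) : Set (Fin T → GossipContacts n)) := by
    ext c
    simp [nonempty_iff_ne_empty]
  have hadd := card_filter_add_card_filter_not (s := (univ : Finset (Fin T → GossipContacts n)))
    (fun c => uninformed U T c = ∅)
  rw [card_univ] at hadd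
  rw [executionLaw, Measure.prod_prod, measure_univ, one_mul, uniformOn_univ, hset,
    Measure.count_apply_finset]
  rw [ENNReal.le_div_iff_mul_le (Or.inl (by exact_mod_cast hcard.ne'))
    (Or.inl (ENNReal.natCast_ne_top _)), mul_comm, ← mul_div_assoc]
  refine ENNReal.div_le_of_le_mul ?_
  exact_mod_cast (by omega)

/-- If some node is likely to remain without information from the `d` nodes on which the inputs
`1, …, n` and `d + 1, …, n + d` differ, then the algorithm is likely to fail on one of them: such a
node gives the same output on both, and no value is a correct answer for both. -/
lemma GossipAlgorithm.exists_one_div_three_le_failure (A : GossipAlgorithm n) (hn : 2 ≤ n) {T d : ℕ}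
    {ε φ : ℝ} (hdn : d ≤ n) (hd : 2 * ε * n < d)
    (h : 3 * #(univ.filter fun c : Fin T → GossipContacts n =>
      uninformed (univ.filter fun v : Fin n => d ≤ v) T c = ∅) ≤
        Fintype.card (Fin T → GossipContacts n)) :
    ∃ x : Fin n → ℕ, Function.Injective x ∧ (∀ v, 1 ≤ x v ∧ x v ≤ 2 * n) ∧
      1 / 3 ≤ A.executionLaw T (A.failure ε φ T x) := by
  have hmain : Set.univ ×ˢ {c | (uninformed (univ.filter fun v : Fin n => d ≤ v) T c).Nonempty} ⊆
      A.failure ε φ T (fun v : Fin n => (v : ℕ) + 1) ∪ A.failure ε φ T (shiftedInput n d) := by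
    rintro ⟨r, c⟩ ⟨-, v, hv⟩
    by_contra hcon
    simp only [failure, Set.mem_union, Set.mem_ofPred_eq, not_or, not_exists, not_not] at hcon
    have h1 := (hcon.1 v).le_of_eq_succ
    have h2 := (hcon.2 v).le_of_forall_lt (shiftedInput_injective n d) (lt_shiftedInput hdn)
    rw [A.run_eq_of_mem_uninformed (y := shiftedInput n d) (fun w hw => ?_) r T c v hv] at h1
    · linarith
    · have := (mem_filter.mp hw).2
      rw [shiftedInput, if_neg (by omega)]
  have hsum := ((A.two_div_three_le_executionLaw hn h).trans (measure_mono hmain)).trans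
    (measure_union_le _ _)
  by_cases hA : 1 / 3 ≤ A.executionLaw T (A.failure ε φ T (fun v : Fin n => (v : ℕ) + 1))
  · exact ⟨_, fun v w hvw => Fin.ext (by simpa using hvw), fun v => ⟨by omega, by omega⟩, hA⟩
  · refine ⟨_, shiftedInput_injective n d,
      fun v => ⟨(Nat.zero_le d).trans_lt (lt_shiftedInput hdn v), shiftedInput_le d v⟩, ?_⟩
    by_contra hB
    refine absurd (hsum.trans_lt (ENNReal.add_lt_add (not_le.mp hA) (not_le.mp hB))) ?_
    rw [ENNReal.div_add_div_same]
    norm_num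

end Failure

/-! ### Numbers of rounds that leave an uninformed node -/

lemma two_pow_four_pow_le_of_lt_logb {n T : ℕ} (hn : 2 ≤ n)
    (h : (T : ℝ) < 1 / 2 * Real.logb 2 (Real.logb 2 n)) : 2 ^ 4 ^ T ≤ n := by
  have hn' : (2 : ℝ) ≤ n := by exact_mod_cast hn
  have hpos : 0 < Real.logb 2 n := Real.logb_pos one_lt_two (by linarith)
  have h1 : ((2 * T : ℕ) : ℝ) < Real.logb 2 (Real.logb 2 n) := by push_cast; linarith
  rw [Real.lt_logb_iff_rpow_lt one_lt_two hpos, Real.rpow_natCast, pow_mul] at h1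
  have h2 : ((4 ^ T : ℕ) : ℝ) < Real.logb 2 n := by
    push_cast
    norm_num at h1
    exact h1
  rw [Real.lt_logb_iff_rpow_lt one_lt_two (by linarith), Real.rpow_natCast] at h2
  exact_mod_cast h2.le

lemma pow_four_mul_two_pow_mono : Monotone fun T : ℕ => 64 ^ (4 * 2 ^ T) := fun _ _ h =>
  Nat.pow_le_pow_right (by norm_num) (Nat.mul_le_mul_left 4 (Nat.pow_le_pow_right (by norm_num) h))

/-- The threshold for `n` makes the hypothesis of the second moment estimate hold for all `T ≤ 15`;
for larger `T` it follows from `24 * 2 ^ T ≤ 4 ^ T`. -/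
lemma pow_four_mul_two_pow_le_of_two_pow_four_pow_le {n T : ℕ} (hn : 64 ^ (4 * 2 ^ 15) ≤ n)
    (h : 2 ^ 4 ^ T ≤ n) : 64 ^ (4 * 2 ^ T) ≤ n := by
  rcases le_total T 15 with hT | hT
  · exact (pow_four_mul_two_pow_mono hT).trans hn
  · refine le_trans ?_ h
    rw [(by norm_num : 64 = 2 ^ 6), ← pow_mul]
    refine Nat.pow_le_pow_right (by norm_num) ?_
    have h15 : 2 ^ 15 ≤ 2 ^ T := Nat.pow_le_pow_right (by norm_num) hT
    rw [(by norm_num : 4 = 2 * 2), mul_pow]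
    nlinarith

theorem mainTheorem3 :
    ∃ N : ℕ, ∀ n : ℕ, N ≤ n → ∀ ε φ : ℝ,
      10 * Real.log n / n < ε → ε < 1 / 8 → 0 ≤ φ → φ ≤ 1 →
      ∀ T : ℕ,
        ((T : ℝ) < 1 / 2 * Real.logb 2 (Real.logb 2 n) ∨ (T : ℝ) < Real.logb 4 (8 / ε)) →
        ∀ A : GossipAlgorithm n,
          ∃ x : Fin n → ℕ, Function.Injective x ∧ (∀ v, 1 ≤ x v ∧ x v ≤ 2 * n) ∧
            1 / 3 ≤ A.executionLaw T (A.failure ε φ T x) := by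
  refine ⟨64 ^ (4 * 2 ^ 15), fun n hn ε φ hε hε8 _ _ T hT A => ?_⟩
  have hn64 : 64 ≤ n := by
    refine le_trans ?_ hn
    exact Nat.le_self_pow (by positivity) 64
  have hnr : (64 : ℝ) ≤ n := by exact_mod_cast hn64
  have hεn : 10 < ε * n := by
    have hlog : 1 ≤ Real.log n := by
      rw [Real.le_log_iff_exp_le (by linarith)]
      linarith [Real.exp_one_lt_d9]
    have := (div_lt_iff₀ (by linarith)).mp hε
    linarith
  have hε0 : 0 < ε := pos_of_mul_pos_left (by linarith) (by linarith : (0 : ℝ) ≤ n)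
  set d := ⌊2 * ε * n⌋₊ + 1 with hd
  have hdlt : 2 * ε * n < d := by
    rw [hd]
    push_cast
    exact Nat.lt_floor_add_one _
  have hdle : (d : ℝ) ≤ 3 * (ε * n) := by
    have := Nat.floor_le (by positivity : 0 ≤ 2 * ε * n)
    rw [hd]
    push_cast
    linarith
  have hd2 : 2 * d ≤ n := by
    have : (2 * d : ℝ) ≤ n := by nlinarith
    exact_mod_cast this
  have hcompl : (univ.filter fun v : Fin n => d ≤ v)ᶜ = univ.filter fun v : Fin n => (v : ℕ) < d := by
    ext v
    simp
  have hcard : #(univ.filter fun v : Fin n => d ≤ v)ᶜ = d := by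
    rw [hcompl, Fin.card_filter_val_lt]
    omega
  have hcardU : n ≤ 2 * #(univ.filter fun v : Fin n => d ≤ v) := by
    have := card_add_card_compl (univ.filter fun v : Fin n => d ≤ v)
    rw [hcard, Fintype.card_fin] at this
    omega
  refine A.exists_one_div_three_le_failure (by omega) (by omega) hdlt ?_
  rcases hT with hT | hT
  · exact three_mul_card_uninformed_eq_empty_le_of_pow_le
      (pow_four_mul_two_pow_le_of_two_pow_four_pow_le hn
        (two_pow_four_pow_le_of_lt_logb (by omega) hT)) hcardU
  rcases le_total T 15 with hT15 | hT15
  · refine three_mul_card_uninformed_eq_empty_le_of_pow_le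
      ((pow_four_mul_two_pow_mono hT15).trans hn) hcardU
  · refine three_mul_card_uninformed_eq_empty_le_of_mul_le (by omega) ?_
    rw [hcard]
    have h4 : ε * 4 ^ T < 8 := by
      rw [Real.lt_logb_iff_rpow_lt (by norm_num) (by positivity), Real.rpow_natCast,
        lt_div_iff₀ hε0] at hT
      linarith
    -- `72 * (3 / 4) ^ 15 < 1`
    have h34 : (72 : ℝ) * 3 ^ T ≤ 4 ^ T := by
      obtain ⟨j, rfl⟩ := Nat.exists_eq_add_of_le hT15
      have : (3 : ℝ) ^ j ≤ 4 ^ j := by gcongr; norm_num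
      rw [pow_add, pow_add]
      nlinarith [pow_pos (three_pos : (0 : ℝ) < 3) j]
    have : (3 * (3 ^ T * d) : ℝ) ≤ n := by
      calc (3 * (3 ^ T * d) : ℝ) ≤ 3 * (3 ^ T * (3 * (ε * n))) := by gcongr
        _ = 72 * 3 ^ T * ε * n / 8 := by ring
        _ ≤ 4 ^ T * ε * n / 8 := by gcongr
        _ = ε * 4 ^ T * n / 8 := by ring
        _ ≤ 8 * n / 8 := by gcongr
        _ = n := by ring
    exact_mod_cast this
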